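/- Let $p$ be a prime number, let $v$ be the $p$-adic valuation on $\mathbb{Q}_p$, and let $|x|_p=p^{-v(x)}$ for $x\neq 0$. Put $\epsilon(x)=|x|_p\,x=p^{-v(x)}x\in\mathbb{Z}_p^{\times}$ for $x\in\mathbb{Q}_p\setminus\{0\}$, and $\epsilon(0)=1$. For $u\in\mathbb{Z}_p$ let $\lfloor u\rfloor_p$ be the unique element of $\{0,\dots,p-1\}$ with $|u-\lfloor u\rfloor_p|_p<1$. Define $\tau\colon\mathbb{Q}_p\to\mathbb{Q}_p$ (Schneider's continued fraction map) and $f\colon\mathbb{Q}_p\to\mathbb{Q}_p$ by $$\tau(x)=\frac{1}{\epsilon(x)}-\left\lfloor\frac{1}{\epsilon(x)}\right\rfloor_p,\qquad f(x)=\sum_{n=0}^{\infty}\left\lfloor\frac{1}{\epsilon(\tau^n(x))}\right\rfloor_p\prod_{m=0}^{n}\frac{\tau^m(x)}{\epsilon(\tau^m(x))},$$ where $\tau^n$ denotes the $n$-fold iterate of $\tau$ and the series converges $p$-adically for every $x\in\mathbb{Q}_p$. Then for every $x\in\mathbb{Q}_p$, $x\in\mathbb{Q}$ if and only if $f(x)\in\mathbb{Z}[\frac1p]$.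 Furthermore, $f(\mathbb{Q})=\mathbb{Z}[\frac1p]$. -/

import Mathlib

noncomputable section

namespace Schneider

variable (p : ℕ) [Fact p.Prime]

theorem norm_zpow_neg_valuation_mul {x : ℚ_[p]} (hx : x ≠ 0) :
    ‖(p : ℚ_[p]) ^ (-x.valuation) * x‖ = 1 := by
  have hp : (p : ℝ) ≠ 0 := by exact_mod_cast (Fact.out : p.Prime).ne_zero
  rw [norm_mul, Padic.norm_p_zpow, Padic.norm_eq_zpow_neg_valuation hx, ← zpow_add₀ hp]
  simp

open Classical in
/-- The unit part `ε : ℚ_p → ℤ_pˣ`: `ε(x) = |x|_p x`, where the rational number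
`|x|_p = p ^ (-v(x))` is regarded as an element of `ℚ_p`, and `ε(0) = 1`. -/
def unitPart (x : ℚ_[p]) : ℤ_[p]ˣ :=
  if hx : x = 0 then 1
  else PadicInt.mkUnits (norm_zpow_neg_valuation_mul p hx)

/-- The leading digit `⌊u⌋_p` of `u ∈ ℤ_p`: the unique element of `{0, …, p - 1}` that is congruent
to `u` modulo `p`. -/
def digit (u : ℤ_[p]) : ℕ := u.zmodRepr

/-- Schneider's continued fraction map `τ(x) = 1 / ε(x) - ⌊1 / ε(x)⌋_p`. -/
def tau (x : ℚ_[p]) : ℚ_[p] :=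
  (((unitPart p x)⁻¹ : ℤ_[p]ˣ) : ℤ_[p]) - (digit p ((unitPart p x)⁻¹ : ℤ_[p]ˣ) : ℚ_[p])

/-- The `n`-th term `⌊1 / ε(τⁿ x)⌋_p ∏_{m = 0}^{n} τᵐ x / ε(τᵐ x)` of the series defining `f`. -/
def term (x : ℚ_[p]) (n : ℕ) : ℚ_[p] :=
  (digit p ((unitPart p ((tau p)^[n] x))⁻¹ : ℤ_[p]ˣ) : ℚ_[p]) *
    ∏ m ∈ Finset.range (n + 1), (tau p)^[m] x / ((unitPart p ((tau p)^[m] x) : ℤ_[p]) : ℚ_[p])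

/-- The map `f(x) = ∑_{n ≥ 0} ⌊1 / ε(τⁿ x)⌋_p ∏_{m = 0}^{n} τᵐ x / ε(τᵐ x)`. The series always
converges, see `summable_term`. -/
def f (x : ℚ_[p]) : ℚ_[p] := ∑' n, term p x n

/-- The subring `ℤ[1/p]` of `ℚ_p`. -/
def zInvP : Subalgebra ℤ ℚ_[p] := Algebra.adjoin ℤ {(1 / p : ℚ_[p])}

theorem norm_tau_le (x : ℚ_[p]) : ‖tau p x‖ ≤ (p : ℝ)⁻¹ := by
  have h := PadicInt.norm_sub_zmodRepr_lt_one ((unitPart p x)⁻¹ : ℤ_[p]ˣ).val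
  have h2 := (PadicInt.norm_le_pow_iff_norm_lt_pow_add_one
    (((unitPart p x)⁻¹ : ℤ_[p]ˣ).val - (((unitPart p x)⁻¹ : ℤ_[p]ˣ).val.zmodRepr : ℤ_[p]))
    (-1)).2 (by simpa using h)
  rw [zpow_neg_one, PadicInt.norm_def] at h2
  simpa [tau, digit] using h2

theorem summable_term (x : ℚ_[p]) : Summable (term p x) := by
  have hp : 1 < (p : ℝ) := by exact_mod_cast (Fact.out : p.Prime).one_lt
  have hu : ∀ u : ℤ_[p]ˣ, ‖((u : ℤ_[p]) : ℚ_[p])‖ = 1 := fun u => PadicInt.norm_units u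
  have hb : ∀ n, ‖term p x n‖ ≤ ‖x‖ * ((p : ℝ)⁻¹) ^ n := by
    intro n
    rw [term, norm_mul, norm_prod, Finset.prod_range_succ']
    have h1 : ‖(digit p ((unitPart p ((tau p)^[n] x))⁻¹ : ℤ_[p]ˣ) : ℚ_[p])‖ ≤ 1 := by
      exact_mod_cast Padic.norm_int_le_one (p := p)
        (digit p ((unitPart p ((tau p)^[n] x))⁻¹ : ℤ_[p]ˣ) : ℤ)
    have h2 : ∏ m ∈ Finset.range n, ‖(tau p)^[m + 1] x /
        ((unitPart p ((tau p)^[m + 1] x) : ℤ_[p]) : ℚ_[p])‖ ≤ ((p : ℝ)⁻¹) ^ n := by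
      calc _ ≤ ∏ m ∈ Finset.range n, (p : ℝ)⁻¹ := by
            refine Finset.prod_le_prod (fun _ _ => norm_nonneg _) (fun m _ => ?_)
            rw [norm_div, hu, div_one, Function.iterate_succ_apply']
            exact norm_tau_le p _
        _ = _ := by simp
    have h3 : ‖(tau p)^[0] x / ((unitPart p ((tau p)^[0] x) : ℤ_[p]) : ℚ_[p])‖ = ‖x‖ := by
      rw [norm_div, hu, div_one, Function.iterate_zero, id]
    rw [h3]
    calc _ ≤ 1 * (((p : ℝ)⁻¹) ^ n * ‖x‖) := by gcongr
      _ = _ := by ring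
  refine Summable.of_norm_bounded ((summable_geometric_of_lt_one (by positivity) ?_).mul_left ‖x‖) hb
  exact inv_lt_one_of_one_lt₀ hp

end Schneider

end

/-!
Every `x ≠ 0` can be written in exactly one way as `x = p ^ v / (d + t)` with `v ∈ ℤ`,
`0 < d < p` and `‖t‖ < 1`. Here `t = τ x` (`exists_eq_zpow_div`, `zpow_mul_inj`), and
`f x = p ^ v * (d + f (τ x))` (`f_zpow_div`). Since moreover `‖f x‖ = ‖x‖` (`norm_f`), the same
uniqueness, applied to `f x`, shows that `f x` determines `v`, `d` and `f (τ x)`. Iterating, `f x`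
determines all the digits and exponents of the continued fraction of `x`, so `f` is injective
(`f_injective`).

The point `-p` is fixed by both `τ` and `f`, since its only digit is `p - 1`. Both inclusions of
`f(ℚ) = ℤ[1/p]` are descents that end at `0` or at `-p`.

* For `x = p ^ a * A / B` with integers `A`, `B` prime to `p`, `τ x = p ^ k * A' / A` where
  `p ^ k * A' = B - d * A`. By convexity of the square, `p * A' ^ 2 + A ^ 2 < p * A ^ 2 + B ^ 2`
  unless `A = ± B` (`quadratic_descent`), and in that case `τ x` is `0` or `-p`.
* For `y = p ^ a * N` with `N` an integer prime to `p`, write `N = d + p ^ k * N'`; then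
  `|N'| < |N|` unless `N = -1`. So `y` is the image of the rational number
  `p ^ a / (d + t)`, where `t` is a rational number with `f t = p ^ k * N'`.

Finally, if `f x ∈ ℤ[1/p]`, then `f x = f q` for a rational `q`, and `x = q` by injectivity.
-/

namespace Schneider

variable {p : ℕ} [Fact p.Prime]

/-! ### Expansions `p ^ v * (d + t)` -/

theorem norm_digit_add {d : ℕ} (h0 : 0 < d) (hd : d < p) {t : ℚ_[p]} (ht : ‖t‖ < 1) :
    ‖(d : ℚ_[p]) + t‖ = 1 := by
  have h : ‖(d : ℚ_[p])‖ = 1 := by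
    rw [Padic.norm_natCast_eq_one_iff]
    exact ((Fact.out : p.Prime).coprime_iff_not_dvd).2 (Nat.not_dvd_of_pos_of_lt h0 hd)
  rw [Padic.add_eq_max_of_ne (by rw [h]; exact ht.ne'), h, max_eq_left ht.le]

theorem digit_add_ne_zero {d : ℕ} (h0 : 0 < d) (hd : d < p) {t : ℚ_[p]} (ht : ‖t‖ < 1) :
    (d : ℚ_[p]) + t ≠ 0 := by
  rw [← norm_ne_zero_iff, norm_digit_add h0 hd ht]
  exact one_ne_zero

theorem natCast_p_ne_zero : (p : ℚ_[p]) ≠ 0 :=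
  Nat.cast_ne_zero.2 (Fact.out : p.Prime).ne_zero

theorem norm_neg_p_lt_one : ‖(-p : ℚ_[p])‖ < 1 := by
  rw [norm_neg]
  exact Padic.norm_p_lt_one

/-- The exponent, the leading digit and the tail of `p ^ v * (d + t)` are unique: the norm determines
`v`, and then reduction modulo `p` determines `d`. -/
theorem zpow_mul_inj {v v' : ℤ} {d d' : ℕ} {t t' : ℚ_[p]} (h0 : 0 < d) (hd : d < p)
    (h0' : 0 < d') (hd' : d' < p) (ht : ‖t‖ < 1) (ht' : ‖t'‖ < 1)
    (h : (p : ℚ_[p]) ^ v * (d + t) = (p : ℚ_[p]) ^ v' * (d' + t')) :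
    v = v' ∧ d = d' ∧ t = t' := by
  have hp1 : 1 < (p : ℝ) := by exact_mod_cast (Fact.out : p.Prime).one_lt
  have hv : v = v' := by
    have hn := congrArg norm h
    rw [norm_mul, norm_mul, norm_digit_add h0 hd ht, norm_digit_add h0' hd' ht',
      Padic.norm_p_zpow, Padic.norm_p_zpow, mul_one, mul_one] at hn
    have := zpow_right_injective₀ (by linarith) hp1.ne' hn
    simpa using this
  subst hv
  have h2 := mul_left_cancel₀ (zpow_ne_zero v natCast_p_ne_zero) h
  have hdd : d = d' := by
    have h3 : (((d : ℤ) - d' : ℤ) : ℚ_[p]) = t' - t := by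
      push_cast
      linear_combination h2
    have h4 : ‖(((d : ℤ) - d' : ℤ) : ℚ_[p])‖ < 1 := by
      rw [h3, sub_eq_add_neg]
      exact (Padic.nonarchimedean _ _).trans_lt (max_lt ht' (by rwa [norm_neg]))
    rw [Padic.norm_intCast_lt_one_iff] at h4
    have := Int.eq_zero_of_abs_lt_dvd h4 (by rw [abs_lt]; constructor <;> lia)
    lia
  subst hdd
  exact ⟨rfl, rfl, add_left_cancel h2⟩

/-! ### One step of the continued fraction -/

theorem coe_unitPart {x : ℚ_[p]} (hx : x ≠ 0) :
    ((unitPart p x : ℤ_[p]) : ℚ_[p]) = (p : ℚ_[p]) ^ (-x.valuation) * x := by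
  rw [unitPart, dif_neg hx]
  rfl

theorem coe_unit_inv (u : ℤ_[p]ˣ) :
    (((u⁻¹ : ℤ_[p]ˣ) : ℤ_[p]) : ℚ_[p]) = ((u : ℤ_[p]) : ℚ_[p])⁻¹ := by
  refine eq_inv_of_mul_eq_one_left ?_
  rw [← PadicInt.coe_mul, Units.inv_mul, PadicInt.coe_one]

theorem norm_tau_lt_one (x : ℚ_[p]) : ‖tau p x‖ < 1 :=
  (norm_tau_le p x).trans_lt
    (inv_lt_one_of_one_lt₀ (by exact_mod_cast (Fact.out : p.Prime).one_lt))

theorem digit_unit_pos (u : ℤ_[p]ˣ) : 0 < digit p u := by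
  refine Nat.pos_of_ne_zero fun h => ?_
  have h1 := PadicInt.norm_sub_zmodRepr_lt_one (u : ℤ_[p])
  rw [digit] at h
  rw [h, Nat.cast_zero, sub_zero, PadicInt.norm_units] at h1
  exact lt_irrefl _ h1

theorem term_zero_left (n : ℕ) : term p 0 n = 0 := by
  rw [term, Finset.prod_range_succ']
  simp

theorem f_zero : f p 0 = 0 := by
  simp [f, term_zero_left]

theorem div_unitPart {x : ℚ_[p]} (hx : x ≠ 0) :
    x / ((unitPart p x : ℤ_[p]) : ℚ_[p]) = (p : ℚ_[p]) ^ x.valuation := by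
  rw [coe_unitPart hx, zpow_neg]
  field_simp

theorem term_zero_right (x : ℚ_[p]) :
    term p x 0 = digit p ((unitPart p x)⁻¹ : ℤ_[p]ˣ) * (x / ((unitPart p x : ℤ_[p]) : ℚ_[p])) := by
  simp [term]

theorem term_succ (x : ℚ_[p]) (n : ℕ) :
    term p x (n + 1) = x / ((unitPart p x : ℤ_[p]) : ℚ_[p]) * term p (tau p x) n := by
  rw [term, term, Finset.prod_range_succ']
  simp only [Function.iterate_succ_apply, Function.iterate_zero_apply]
  ring

theorem f_eq_add (x : ℚ_[p]) :
    f p x = x / ((unitPart p x : ℤ_[p]) : ℚ_[p]) *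
      (digit p ((unitPart p x)⁻¹ : ℤ_[p]ˣ) + f p (tau p x)) := by
  rw [f, (summable_term p x).tsum_eq_zero_add, term_zero_right]
  simp only [term_succ]
  rw [tsum_mul_left, ← f]
  ring

/-- A nonzero `x` is `p ^ v / (d + τ x)` for a nonzero digit `d`, and `f` replaces this quotient by
a product. -/
theorem exists_eq_zpow_div {x : ℚ_[p]} (hx : x ≠ 0) :
    ∃ (v : ℤ) (d : ℕ), 0 < d ∧ d < p ∧ x = (p : ℚ_[p]) ^ v / (d + tau p x) ∧
      f p x = (p : ℚ_[p]) ^ v * (d + f p (tau p x)) := by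
  refine ⟨x.valuation, digit p ((unitPart p x)⁻¹ : ℤ_[p]ˣ), digit_unit_pos _,
    PadicInt.zmodRepr_lt_p _, ?_, ?_⟩
  · rw [tau, add_sub_cancel, coe_unit_inv, ← div_unitPart hx, div_inv_eq_mul, div_mul_cancel₀]
    exact PadicInt.coe_ne_zero.2 (Units.ne_zero _)
  · rw [← div_unitPart hx]
    exact f_eq_add x

theorem zpow_div_ne_zero (v : ℤ) {d : ℕ} (h0 : 0 < d) (hd : d < p) {t : ℚ_[p]} (ht : ‖t‖ < 1) :
    (p : ℚ_[p]) ^ v / (d + t) ≠ 0 :=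
  div_ne_zero (zpow_ne_zero _ natCast_p_ne_zero) (digit_add_ne_zero h0 hd ht)

/-- The step formula for `f` with an arbitrary tail `t` in place of `τ x`. The tail of the quotient
is `t` by uniqueness of the expansion of its inverse, `p ^ (-v) * (d + t)`. -/
theorem f_zpow_div (v : ℤ) {d : ℕ} (h0 : 0 < d) (hd : d < p) {t : ℚ_[p]} (ht : ‖t‖ < 1) :
    f p ((p : ℚ_[p]) ^ v / (d + t)) = (p : ℚ_[p]) ^ v * (d + f p t) := by
  obtain ⟨w, e, he0, he, hx, hf⟩ := exists_eq_zpow_div (zpow_div_ne_zero v h0 hd ht)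
  have h := congrArg Inv.inv hx
  rw [inv_div, inv_div, div_eq_mul_inv, div_eq_mul_inv, ← zpow_neg, ← zpow_neg, mul_comm,
    mul_comm (_ + _)] at h
  obtain ⟨h1, rfl, h3⟩ := zpow_mul_inj h0 hd he0 he ht (norm_tau_lt_one _) h
  obtain rfl := neg_inj.1 h1
  rwa [← h3] at hf

/-! ### `f` preserves the norm and is injective -/

theorem norm_term_le (x : ℚ_[p]) (n : ℕ) : ‖term p x n‖ ≤ ‖x‖ := by
  induction n generalizing x with
  | zero =>
    rw [term_zero_right, norm_mul, norm_div, ← PadicInt.norm_def, PadicInt.norm_units, div_one]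
    exact mul_le_of_le_one_left (norm_nonneg _) (by exact_mod_cast Padic.norm_int_le_one _)
  | succ n ih =>
    rw [term_succ, norm_mul, norm_div, ← PadicInt.norm_def, PadicInt.norm_units, div_one]
    exact mul_le_of_le_one_right (norm_nonneg _) ((ih _).trans (norm_tau_lt_one x).le)

theorem norm_f_le (x : ℚ_[p]) : ‖f p x‖ ≤ ‖x‖ :=
  IsUltrametricDist.norm_tsum_le_of_forall_le_of_nonneg (norm_nonneg _) (norm_term_le x)

theorem norm_f_tau_lt_one (x : ℚ_[p]) : ‖f p (tau p x)‖ < 1 :=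
  (norm_f_le _).trans_lt (norm_tau_lt_one x)

theorem norm_f (x : ℚ_[p]) : ‖f p x‖ = ‖x‖ := by
  rcases eq_or_ne x 0 with rfl | hx
  · rw [f_zero]
  obtain ⟨v, d, h0, hd, hx, hf⟩ := exists_eq_zpow_div hx
  rw [hf, norm_mul, norm_digit_add h0 hd (norm_f_tau_lt_one x), mul_one]
  conv_rhs => rw [hx, norm_div, norm_digit_add h0 hd (norm_tau_lt_one x), div_one]

/-- If `f x = f y`, then `x` and `y` agree in the first `n` digits and exponents of their continued
fractions, hence are close to each other. -/
theorem norm_sub_le_of_f_eq (n : ℕ) {x y : ℚ_[p]} (h : f p x = f p y) :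
    ‖x - y‖ ≤ ‖x‖ * ((p : ℝ)⁻¹) ^ n := by
  have hxy : ‖x‖ = ‖y‖ := by rw [← norm_f, h, norm_f]
  induction n generalizing x y with
  | zero =>
    rw [pow_zero, mul_one, sub_eq_add_neg]
    refine (Padic.nonarchimedean _ _).trans ?_
    rw [norm_neg, hxy, max_self]
  | succ n ih =>
    rcases eq_or_ne x 0 with rfl | hx
    · rw [norm_zero, eq_comm, norm_eq_zero] at hxy
      simp [hxy]
    have hy : y ≠ 0 := by
      rwa [← norm_ne_zero_iff, ← hxy, norm_ne_zero_iff]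
    obtain ⟨v, d, h0, hd, hx', hf⟩ := exists_eq_zpow_div hx
    obtain ⟨w, e, he0, he, hy', hg⟩ := exists_eq_zpow_div hy
    rw [hf, hg] at h
    obtain ⟨rfl, rfl, h3⟩ :=
      zpow_mul_inj h0 hd he0 he (norm_f_tau_lt_one x) (norm_f_tau_lt_one y) h
    have hu := norm_digit_add h0 hd (norm_tau_lt_one x)
    have hw := norm_digit_add h0 hd (norm_tau_lt_one y)
    have hu0 := digit_add_ne_zero h0 hd (norm_tau_lt_one x)
    have hw0 := digit_add_ne_zero h0 hd (norm_tau_lt_one y)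
    have hnx : ‖x‖ = ‖(p : ℚ_[p]) ^ v‖ := by
      conv_lhs => rw [hx', norm_div, hu, div_one]
    have key : x - y = (p : ℚ_[p]) ^ v * (tau p y - tau p x) / ((d + tau p x) * (d + tau p y)) := by
      conv_lhs => rw [hx', hy']
      field_simp
      ring
    rw [key, norm_div, norm_mul, norm_mul, hu, hw, mul_one, div_one, ← hnx, norm_sub_rev]
    refine mul_le_mul_of_nonneg_left ?_ (norm_nonneg _)
    rw [pow_succ']
    exact (ih h3 (by rw [← norm_f, h3, norm_f])).trans
      (mul_le_mul_of_nonneg_right (norm_tau_le p x) (by positivity))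

theorem f_injective : Function.Injective (f p) := by
  intro x y h
  have hp : (p : ℝ)⁻¹ < 1 :=
    inv_lt_one_of_one_lt₀ (by exact_mod_cast (Fact.out : p.Prime).one_lt)
  have hlim : Filter.Tendsto (fun n : ℕ => ‖x‖ * ((p : ℝ)⁻¹) ^ n) Filter.atTop (nhds 0) := by
    simpa using (tendsto_pow_atTop_nhds_zero_of_lt_one (by positivity) hp).const_mul ‖x‖
  have h0 : ‖x - y‖ ≤ 0 := ge_of_tendsto' hlim fun n => norm_sub_le_of_f_eq n h
  exact sub_eq_zero.1 (norm_le_zero_iff.1 h0)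

/-! ### Special values -/

theorem natCast_pred_p : ((p - 1 : ℕ) : ℚ_[p]) = p - 1 := by
  rw [Nat.cast_sub (Fact.out : p.Prime).one_le, Nat.cast_one]

/-- `-p ^ a = p ^ a / ((p - 1) + (-p))`, so the tail of the continued fraction of `-p ^ a` is
`-p`. -/
theorem f_neg_zpow_eq_add (a : ℤ) :
    f p (-(p : ℚ_[p]) ^ a) = (p : ℚ_[p]) ^ a * (p - 1 + f p (-p)) := by
  have hp := (Fact.out : p.Prime).two_le
  have h := f_zpow_div a (d := p - 1) (by lia) (by lia) (norm_neg_p_lt_one (p := p))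
  rw [natCast_pred_p] at h
  rw [← h]
  congr 1
  rw [show (p : ℚ_[p]) - 1 + -p = -1 by ring, div_neg, div_one]

theorem f_neg_p : f p (-p : ℚ_[p]) = -p := by
  have h := f_neg_zpow_eq_add (p := p) 1
  rw [zpow_one] at h
  have h1 : (1 - p : ℚ_[p]) ≠ 0 := by
    rw [sub_ne_zero]
    exact_mod_cast (Fact.out : p.Prime).one_lt.ne
  refine mul_left_cancel₀ h1 ?_
  linear_combination h

theorem f_neg_zpow (a : ℤ) : f p (-(p : ℚ_[p]) ^ a) = -(p : ℚ_[p]) ^ a := by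
  rw [f_neg_zpow_eq_add, f_neg_p]
  ring

theorem f_zpow (a : ℤ) : f p ((p : ℚ_[p]) ^ a) = (p : ℚ_[p]) ^ a := by
  have h := f_zpow_div (p := p) a (d := 1) one_pos (Fact.out : p.Prime).one_lt (t := 0) (by simp)
  simpa [f_zero] using h

/-! ### The ring `ℤ[1/p]` -/

theorem zpow_mem_zInvP (a : ℤ) : (p : ℚ_[p]) ^ a ∈ zInvP p := by
  cases a with
  | ofNat n =>
    rw [Int.ofNat_eq_natCast, zpow_natCast]
    exact pow_mem (natCast_mem (zInvP p) p) n
  | negSucc n =>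
    rw [zpow_negSucc, ← inv_pow, inv_eq_one_div]
    have h : (1 / p : ℚ_[p]) ∈ zInvP p := Algebra.subset_adjoin (Set.mem_singleton _)
    exact pow_mem h (n + 1)

theorem exists_eq_zpow_mul_of_mem_zInvP {y : ℚ_[p]} (hy : y ∈ zInvP p) :
    ∃ (n : ℕ) (N : ℤ), y = (p : ℚ_[p]) ^ (-n : ℤ) * N := by
  have hp : (p : ℚ_[p]) ≠ 0 := natCast_p_ne_zero
  induction hy using Algebra.adjoin_induction with
  | mem x hx =>
    rw [Set.mem_singleton_iff] at hx
    exact ⟨1, 1, by simp [hx]⟩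
  | algebraMap r => exact ⟨0, r, by simp⟩
  | add x y _ _ hx hy =>
    obtain ⟨n, N, rfl⟩ := hx
    obtain ⟨m, M, rfl⟩ := hy
    refine ⟨n + m, N * p ^ m + M * p ^ n, ?_⟩
    simp only [Nat.cast_add, zpow_neg, neg_add, zpow_add₀ hp, zpow_natCast]
    push_cast
    field_simp
  | mul x y _ _ hx hy =>
    obtain ⟨n, N, rfl⟩ := hx
    obtain ⟨m, M, rfl⟩ := hy
    refine ⟨n + m, N * M, ?_⟩
    simp only [Nat.cast_add, neg_add, zpow_add₀ hp]
    push_cast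
    ring

/-! ### Integers prime to `p` -/

theorem exists_eq_pow_mul_not_dvd {M : ℤ} (hM : M ≠ 0) :
    ∃ (k : ℕ) (N : ℤ), M = p ^ k * N ∧ ¬ (p : ℤ) ∣ N := by
  have hp := (Fact.out : p.Prime)
  have hfin : FiniteMultiplicity (p : ℤ) M :=
    Int.finiteMultiplicity_iff.2 ⟨by simpa using hp.one_lt.ne', hM⟩
  obtain ⟨N, h1, h2⟩ := hfin.exists_eq_pow_mul_and_not_dvd
  exact ⟨_, N, h1, h2⟩

theorem p_mul_abs_le_of_dvd {M : ℤ} {k : ℕ} {N : ℤ} (h : M = p ^ k * N) (hN : ¬ (p : ℤ) ∣ N)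
    (hM : (p : ℤ) ∣ M) : p * |N| ≤ |M| := by
  have hp : 0 < (p : ℤ) := by exact_mod_cast (Fact.out : p.Prime).pos
  cases k with
  | zero => exact absurd (by simpa [h] using hM) hN
  | succ k =>
    rw [h, abs_mul, abs_of_pos (pow_pos hp _), pow_succ, mul_assoc]
    exact le_mul_of_one_le_left (by positivity) (one_le_pow₀ (by lia))

/-- The leading digit of the `p`-adic unit `B / A`. -/
theorem exists_digit {A B : ℤ} (hA : ¬ (p : ℤ) ∣ A) (hB : ¬ (p : ℤ) ∣ B) :
    ∃ d : ℕ, 0 < d ∧ d < p ∧ (p : ℤ) ∣ B - d * A := by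
  have hA' : (A : ZMod p) ≠ 0 := by rwa [Ne, ZMod.intCast_zmod_eq_zero_iff_dvd]
  have hB' : (B : ZMod p) ≠ 0 := by rwa [Ne, ZMod.intCast_zmod_eq_zero_iff_dvd]
  refine ⟨((B : ZMod p) / A).val, ?_, ZMod.val_lt _, ?_⟩
  · rw [ZMod.val_pos]
    exact div_ne_zero hB' hA'
  · rw [← ZMod.intCast_zmod_eq_zero_iff_dvd]
    push_cast
    rw [ZMod.natCast_zmod_val, div_mul_cancel₀ _ hA', sub_self]

/-- The form `p * A ^ 2 + B ^ 2` decreases along the step `(A, B) ↦ (A', A)`, by strict convexity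
of the square: `(|B| + (p - 1) * |A|) ^ 2 < p * (B ^ 2 + (p - 1) * A ^ 2)` when `|A| ≠ |B|`. -/
theorem quadratic_descent {P d A B A' : ℤ} (hP : 1 < P) (h0 : 0 < d) (hd : d < P)
    (hAB : |A| ≠ |B|) (h : P * |A'| ≤ |B - d * A|) :
    P * A' ^ 2 + A ^ 2 < P * A ^ 2 + B ^ 2 := by
  have h1 : P * |A'| ≤ |B| + (P - 1) * |A| := by
    calc P * |A'| ≤ |B - d * A| := h
      _ ≤ |B| + |d * A| := abs_sub _ _
      _ = |B| + d * |A| := by rw [abs_mul, abs_of_pos h0]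
      _ ≤ |B| + (P - 1) * |A| := by gcongr; lia
  have h2 : (P * |A'|) ^ 2 ≤ (|B| + (P - 1) * |A|) ^ 2 :=
    pow_le_pow_left₀ (by positivity) h1 2
  have h3 : 0 < (P - 1) * (|A| - |B|) ^ 2 :=
    mul_pos (by lia) (by have := sub_ne_zero.2 hAB; positivity)
  have h4 : P * (P * |A'| ^ 2) < P * (|B| ^ 2 + (P - 1) * |A| ^ 2) := by nlinarith
  have h5 := lt_of_mul_lt_mul_left h4 (by lia)
  simp only [sq_abs] at h5
  linarith

/-! ### The image of the rational numbers -/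

/-- The continued fraction of a rational number ends at `0` or at `-p`, by descent on
`p * A ^ 2 + B ^ 2`. -/
theorem f_zpow_mul_div_mem_zInvP (a : ℤ) {A B : ℤ} (hA : ¬ (p : ℤ) ∣ A)
    (hB : ¬ (p : ℤ) ∣ B) :
    f p ((p : ℚ_[p]) ^ a * (A / B)) ∈ zInvP p := by
  have hp := (Fact.out : p.Prime)
  induction hn : (p * A ^ 2 + B ^ 2).toNat using Nat.strong_induction_on generalizing a A B with
  | _ n ih =>
  have hA0 : (A : ℚ_[p]) ≠ 0 := by
    rw [Int.cast_ne_zero]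
    rintro rfl
    exact hA (dvd_zero _)
  have hB0 : (B : ℚ_[p]) ≠ 0 := by
    rw [Int.cast_ne_zero]
    rintro rfl
    exact hB (dvd_zero _)
  by_cases hAB : |A| = |B|
  · rcases abs_eq_abs.1 hAB with rfl | rfl
    · rw [div_self hA0, mul_one, f_zpow]
      exact zpow_mem_zInvP a
    · rw [Int.cast_neg, neg_div, div_self hB0, mul_neg, mul_one, f_neg_zpow]
      exact neg_mem (zpow_mem_zInvP a)
  obtain ⟨d, h0, hd, hdvd⟩ := exists_digit hA hB
  have hnA : ‖(A : ℚ_[p])‖ = 1 :=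
    le_antisymm (Padic.norm_int_le_one _)
      (not_lt.1 fun h => hA (Padic.norm_intCast_lt_one_iff.1 h))
  have ht : ‖((B - d * A : ℤ) : ℚ_[p]) / A‖ < 1 := by
    rw [norm_div, hnA, div_one]
    exact Padic.norm_intCast_lt_one_iff.2 hdvd
  have hx : (p : ℚ_[p]) ^ a * (A / B) =
      (p : ℚ_[p]) ^ a / (d + ((B - d * A : ℤ) : ℚ_[p]) / A) := by
    have : (d : ℚ_[p]) + ((B - d * A : ℤ) : ℚ_[p]) / A = B / A := by
      push_cast
      field_simp
      ring
    rw [this]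
    field_simp
  rw [hx, f_zpow_div a h0 hd ht]
  refine mul_mem (zpow_mem_zInvP a) (add_mem (natCast_mem _ _) ?_)
  rcases eq_or_ne (B - d * A) 0 with hM | hM
  · rw [hM, Int.cast_zero, zero_div, f_zero]
    exact zero_mem _
  obtain ⟨k, A', hk, hA'⟩ := exists_eq_pow_mul_not_dvd (p := p) hM
  have hdesc := quadratic_descent (by exact_mod_cast hp.one_lt) (by exact_mod_cast h0)
    (by exact_mod_cast hd) hAB (p_mul_abs_le_of_dvd hk hA' hdvd)
  have hpos : 0 ≤ p * A' ^ 2 + A ^ 2 := by positivity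
  have := ih (p * A' ^ 2 + A ^ 2).toNat (hn ▸ (Int.toNat_lt_toNat (hpos.trans_lt hdesc)).2 hdesc)
    k hA' hA rfl
  rw [hk]
  push_cast
  rwa [mul_div_assoc, ← zpow_natCast]

theorem f_ratCast_mem_zInvP (q : ℚ) : f p (q : ℚ_[p]) ∈ zInvP p := by
  rcases eq_or_ne q 0 with rfl | hq
  · rw [Rat.cast_zero, f_zero]
    exact zero_mem _
  obtain ⟨k, A, hk, hA⟩ := exists_eq_pow_mul_not_dvd (p := p) (Rat.num_ne_zero.2 hq)
  obtain ⟨l, B, hl, hB⟩ := exists_eq_pow_mul_not_dvd (p := p)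
    (Int.natCast_ne_zero.2 q.den_ne_zero)
  have hp : (p : ℚ_[p]) ≠ 0 := natCast_p_ne_zero
  have hden : (q.den : ℚ_[p]) = p ^ l * B := by exact_mod_cast congrArg (Int.cast (R := ℚ_[p])) hl
  have h : (q : ℚ_[p]) = (p : ℚ_[p]) ^ (k - l : ℤ) * (A / B) := by
    rw [Rat.cast_def, hk, hden, zpow_sub₀ hp, zpow_natCast, zpow_natCast, div_mul_div_comm]
    push_cast
    rfl
  rw [h]
  exact f_zpow_mul_div_mem_zInvP _ hA hB

/-- The rational preimage is built digit by digit, by descent on `|N|`; the case `N = -1` is the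
periodic one, where `N - (p - 1) = -p = p * N`. -/
theorem exists_ratCast_f_eq_zpow_mul (a : ℤ) {N : ℤ} (hN : ¬ (p : ℤ) ∣ N) :
    ∃ q : ℚ, f p (q : ℚ_[p]) = (p : ℚ_[p]) ^ a * N := by
  have hp := (Fact.out : p.Prime)
  induction hn : N.natAbs using Nat.strong_induction_on generalizing a N with
  | _ n ih =>
  rcases eq_or_ne N (-1) with rfl | hN1
  · refine ⟨-p ^ a, ?_⟩
    push_cast
    rw [f_neg_zpow, mul_neg, mul_one]
  obtain ⟨d, h0, hd, hdvd⟩ := exists_digit (p := p) (A := 1)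
    (by exact_mod_cast hp.one_lt.ne' ∘ Nat.dvd_one.1) hN
  rw [mul_one] at hdvd
  -- The remaining digits form the integer `N - d`, which has to be hit by a rational number.
  obtain ⟨t, ht⟩ : ∃ t : ℚ, f p (t : ℚ_[p]) = ((N - d : ℤ) : ℚ_[p]) := by
    rcases eq_or_ne (N - d) 0 with hM | hM
    · exact ⟨0, by rw [hM, Rat.cast_zero, f_zero, Int.cast_zero]⟩
    obtain ⟨k, N', hk, hN'⟩ := exists_eq_pow_mul_not_dvd (p := p) hM
    have h1 := p_mul_abs_le_of_dvd hk hN' hdvd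
    -- If `N < 0`, then `p * |N'| ≤ |N| + p - 1`, which is less than `p * |N|` as `N ≠ -1`.
    have h2 : |N'| < |N| := by
      have hN0 : N ≠ 0 := by
        rintro rfl
        exact hN (dvd_zero _)
      have hp2 : (2 : ℤ) ≤ p := by exact_mod_cast hp.two_le
      have hd' : (d : ℤ) ≤ p - 1 := by lia
      by_contra! hle
      rcases lt_or_gt_of_ne hN0 with hneg | hpos
      · rw [abs_of_neg hneg] at hle
        rw [abs_of_neg (show N - d < 0 by lia)] at h1
        have hN2 : 2 ≤ -N := by lia
        nlinarith
      · rw [abs_of_pos hpos] at hle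
        have h3 : |N - d| < max N p := by
          rw [abs_lt]
          constructor <;> lia
        rcases le_total N p with h4 | h4
        · rw [max_eq_right h4] at h3
          nlinarith
        · rw [max_eq_left h4] at h3
          nlinarith
    obtain ⟨t, ht⟩ := ih N'.natAbs (hn ▸ by zify; exact h2) k hN' rfl
    refine ⟨t, ?_⟩
    rw [ht, hk]
    push_cast
    rw [zpow_natCast]
  have hnt : ‖(t : ℚ_[p])‖ < 1 := by
    rw [← norm_f, ht]
    exact Padic.norm_intCast_lt_one_iff.2 hdvd
  refine ⟨p ^ a / (d + t), ?_⟩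
  push_cast
  rw [f_zpow_div a h0 hd hnt, ht]
  push_cast
  ring

theorem exists_ratCast_f_eq {y : ℚ_[p]} (hy : y ∈ zInvP p) : ∃ q : ℚ, f p (q : ℚ_[p]) = y := by
  obtain ⟨n, N, rfl⟩ := exists_eq_zpow_mul_of_mem_zInvP hy
  rcases eq_or_ne N 0 with rfl | hN
  · exact ⟨0, by rw [Rat.cast_zero, f_zero, Int.cast_zero, mul_zero]⟩
  obtain ⟨k, M, rfl, hM⟩ := exists_eq_pow_mul_not_dvd (p := p) hN
  obtain ⟨q, hq⟩ := exists_ratCast_f_eq_zpow_mul (-n + k) hM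
  refine ⟨q, ?_⟩
  rw [hq, zpow_add₀ natCast_p_ne_zero, zpow_natCast]
  push_cast
  ring

end Schneider

theorem theorem3p5 (p : ℕ) [Fact p.Prime] :
    (∀ x : ℚ_[p], x ∈ Set.range (fun q : ℚ => (q : ℚ_[p])) ↔ Schneider.f p x ∈ Schneider.zInvP p) ∧
      Schneider.f p '' Set.range (fun q : ℚ => (q : ℚ_[p])) = (Schneider.zInvP p : Set ℚ_[p]) := by
  refine ⟨fun x => ⟨?_, fun hx => ?_⟩, Set.Subset.antisymm ?_ fun y hy => ?_⟩
  · rintro ⟨q, rfl⟩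
    exact Schneider.f_ratCast_mem_zInvP q
  · obtain ⟨q, hq⟩ := Schneider.exists_ratCast_f_eq hx
    exact ⟨q, Schneider.f_injective hq⟩
  · rintro _ ⟨_, ⟨q, rfl⟩, rfl⟩
    exact Schneider.f_ratCast_mem_zInvP q
  · obtain ⟨q, hq⟩ := Schneider.exists_ratCast_f_eq hy
    exact ⟨q, ⟨q, rfl⟩, hq⟩
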